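/- **Setting.** A distribution feeder has nodes $\mathcal N=\{0,\dots,N\}$ joined by lines $(m,n)\in\mathcal E$ with series and shunt admittances $y_{mn},y^{\rm sh}_{mn}$, and admittance matrix $[\mathbf Y]_{mm}=\sum_{j:(m,j)\in\mathcal E}(y^{\rm sh}_{mj}+y_{mj})$, $[\mathbf Y]_{mn}=-y_{mn}$ for $(m,n)\in\mathcal E$, and $0$ otherwise. Put $\mathbf Y_n=\mathbf e_n\mathbf e_n^{\mathsf T}\mathbf Y$, $\mathbf A_n=\tfrac12(\mathbf Y_n+\mathbf Y_n^{\mathsf H})$, $\mathbf B_n=\tfrac{\mathrm j}{2}(\mathbf Y_n-\mathbf Y_n^{\mathsf H})$, $\mathbf M_n=\mathbf e_n\mathbf e_n^{\mathsf T}$. Let $\mathcal U,\mathcal H\subset\mathcal N$ be the poles and the homes with a PV inverter, let $P_{\ell,h},Q_{\ell,h},P^{\rm av}_h,S_h$ be real data for $h\in\mathcal H$, and let $\theta\in[0,\pi/2]$. The operating region of inverter $h$ is $$\mathcal F_h=\{(P,Q):0\le P\le P_h^{\rm av},\ Q^2\le S_h^2-(P_h^{\rm av}-P)^2,\ |Q|\le\tan\theta\,(P_h^{\rm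 av}-P)\},$$ the last constraint being void for $\theta=\pi/2$. Say that $(\mathbf V,\mathbf p,\mathbf q)$, with $\mathbf V\in\mathbb C^{(N+1)\times(N+1)}$ and $\mathbf p,\mathbf q\in\mathbb R^{\mathcal H}$, is *network feasible* if $\mathbf V\succeq0$, ${\rm Tr}(\mathbf A_h\mathbf V)=-P_{\ell,h}+P_h^{\rm av}-P_h$ and ${\rm Tr}(\mathbf B_h\mathbf V)=-Q_{\ell,h}+Q_h$ for all $h\in\mathcal H$, ${\rm Tr}(\mathbf A_n\mathbf V)={\rm Tr}(\mathbf B_n\mathbf V)=0$ for all $n\in\mathcal U$, and $V_{\min}^2\le{\rm Tr}(\mathbf M_n\mathbf V)\le V_{\max}^2$ for all $n\in\mathcal N$. Let $C_{\rm utility}(\mathbf V,\mathbf p)$ be a real-valued convex function of the Hermitian matrix $\mathbf V$ and of $\mathbf p\in\mathbb R^{\mathcal H}$, let $R_h:\mathbb R\to\mathbb R$ be convex (for example $R_h(P)=a_hP^2+b_hP$ with $a_h\ge0$), let $\lambda\ge0$, $G(\mathbf p,\mathbf q)=\lambda\sum_h\|(P_h,Q_h)\|_2$ and $\bar C(\mathbf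 V,\mathbf p,\mathbf q)=C_{\rm utility}(\mathbf V,\mathbf p)+G(\mathbf p,\mathbf q)$. The *relaxed SDP problem* (5) is to minimize $\bar C(\mathbf V,\mathbf p,\mathbf q)+\sum_hR_h(P_h)$ over the network feasible $(\mathbf V,\mathbf p,\mathbf q)$ with $(P_h,Q_h)\in\mathcal F_h$ for all $h$. Its *consensus form* (6) is to minimize $\bar C(\mathbf V,\bar{\mathbf p},\bar{\mathbf q})+\sum_hR_h(P_h)$ over the network feasible $(\mathbf V,\bar{\mathbf p},\bar{\mathbf q})$ and all $(P_h,Q_h)\in\mathcal F_h$, $h\in\mathcal H$, subject to $\bar{\mathbf p}=\mathbf p$, $\bar{\mathbf q}=\mathbf q$. Assume the constraint qualification that some $(\mathbf p,\mathbf q)$ lies both in the relative interior of $\{(\mathbf p,\mathbf q):(\mathbf V,\mathbf p,\mathbf q)\text{ is network feasible for some }\mathbf V\}$ and in the relative interior of $\{(\mathbf p,\mathbf q):(P_h,Q_h)\in\mathcal F_h\ \forall h\in\mathcal H\}$. **Algorithm.** Fix $\kappa>0$. Start from $\gamma_h[0]=\mu_h[0]=0$ and arbitrary $\mathbf p[0],\mathbf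 q[0],\bar{\mathbf p}[0],\bar{\mathbf q}[0]$. For $i=0,1,2,\dots$ let $(\mathbf V[i+1],\bar{\mathbf p}[i+1],\bar{\mathbf q}[i+1])$ be any minimizer, over all network feasible $(\mathbf V,\bar{\mathbf p},\bar{\mathbf q})$, of $$\bar C(\mathbf V,\bar{\mathbf p},\bar{\mathbf q})+\sum_h\Big[\tfrac\kappa2(\bar P_h^2+\bar Q_h^2)+\bar P_h\big(\gamma_h[i]-\tfrac\kappa2\bar P_h[i]-\tfrac\kappa2P_h[i]\big)+\bar Q_h\big(\mu_h[i]-\tfrac\kappa2\bar Q_h[i]-\tfrac\kappa2Q_h[i]\big)\Big];$$ for each $h$ let $(P_h[i+1],Q_h[i+1])$ minimize, over $(P,Q)\in\mathcal F_h$, $$R_h(P)+\tfrac\kappa2(P^2+Q^2)-P\big(\gamma_h[i]+\tfrac\kappa2\bar P_h[i]+\tfrac\kappa2P_h[i]\big)-Q\big(\mu_h[i]+\tfrac\kappa2\bar Q_h[i]+\tfrac\kappa2Q_h[i]\big);$$ and put $\gamma_h[i+1]=\gamma_h[i]+\tfrac\kappa2(\bar P_h[i+1]-P_h[i+1])$,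 $\mu_h[i+1]=\mu_h[i]+\tfrac\kappa2(\bar Q_h[i+1]-Q_h[i+1])$. **Proposition.** Problems (5) and (6) are equivalent: $(\mathbf V,\bar{\mathbf p},\bar{\mathbf q},\mathbf p,\mathbf q)$ solves (6) if and only if $\bar{\mathbf p}=\mathbf p$, $\bar{\mathbf q}=\mathbf q$ and $(\mathbf V,\mathbf p,\mathbf q)$ solves (5). For every $\kappa>0$ and every sequence of iterates produced by the algorithm there is an optimal solution $(\mathbf V^{\rm opt},\mathbf p^{\rm opt},\mathbf q^{\rm opt})$ of (5) such that $\lim\mathbf p[i]=\lim\bar{\mathbf p}[i]=\mathbf p^{\rm opt}$ and $\lim\mathbf q[i]=\lim\bar{\mathbf q}[i]=\mathbf q^{\rm opt}$, and the dual variables $\gamma[i],\mu[i]$ converge. Every cluster point $\mathbf V$ of $(\mathbf V[i])$ makes $(\mathbf V,\mathbf p^{\rm opt},\mathbf q^{\rm opt})$ optimal for (5); and if $\mathbf V^{\rm opt}$ is the only matrix with this property (in particular if (5) has a unique optimal solution), then $\lim\mathbf V[i]=\mathbf V^{\rm opt}$. -/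

import Mathlib

open scoped ComplexOrder

noncomputable section

/-- The data of a distribution feeder with nodes `0, …, N`: its lines with their series and shunt
admittances, the utility poles and the homes that have a PV inverter, the loads, the available
PV powers and the ratings of the inverters, the power-factor angle, and the voltage limits. -/
structure Feeder (N : ℕ) where
  lines : SimpleGraph (Fin (N + 1))
  ySeries : Sym2 (Fin (N + 1)) → ℂ
  yShunt : Sym2 (Fin (N + 1)) → ℂ
  poles : Finset (Fin (N + 1))
  homes : Finset (Fin (N + 1))
  Pload : homes → ℝ
  Qload : homes → ℝ
  Pav : homes → ℝ
  rating : homes → ℝ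
  θ : ℝ
  θ_mem : θ ∈ Set.Icc 0 (Real.pi / 2)
  Vmin : ℝ
  Vmax : ℝ

namespace Feeder

/-- Square complex matrices indexed by the nodes. -/
abbrev NodeMatrix (N : ℕ) : Type := Matrix (Fin (N + 1)) (Fin (N + 1)) ℂ

/-- A vector with one real entry per inverter. -/
abbrev Vec {N : ℕ} (net : Feeder N) : Type := net.homes → ℝ

variable {N : ℕ} (net : Feeder N)

open Classical in
/-- The system admittance matrix. -/
def Y : NodeMatrix N := Matrix.of fun m n =>
  if m = n then
    ∑ j ∈ Finset.univ.filter (fun j => net.lines.Adj m j),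
      (net.yShunt s(m, j) + net.ySeries s(m, j))
  else if net.lines.Adj m n then -net.ySeries s(m, n)
  else 0

/-- `M n = eₙ eₙᵀ`. -/
def M (n : Fin (N + 1)) : NodeMatrix N := Matrix.vecMulVec (Pi.single n 1) (Pi.single n 1)

/-- `Yₙ = eₙ eₙᵀ Y`. -/
def Ynode (n : Fin (N + 1)) : NodeMatrix N := M n * net.Y

/-- The Hermitian matrix that gives the active power injected at node `n`. -/
def A (n : Fin (N + 1)) : NodeMatrix N :=
  (1 / 2 : ℂ) • (net.Ynode n + (net.Ynode n).conjTranspose)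

/-- The Hermitian matrix that gives the reactive power injected at node `n`. -/
def B (n : Fin (N + 1)) : NodeMatrix N :=
  (Complex.I / 2) • (net.Ynode n - (net.Ynode n).conjTranspose)

/-- The operating region of inverter `h`: pairs (curtailed active power, reactive power).
For `θ = π / 2` (no limit on the power factor) the last constraint is void. -/
def region (h : net.homes) : Set (ℝ × ℝ) :=
  {z | (0 ≤ z.1 ∧ z.1 ≤ net.Pav h) ∧
    z.2 ^ 2 ≤ net.rating h ^ 2 - (net.Pav h - z.1) ^ 2 ∧
    (net.θ < Real.pi / 2 → |z.2| ≤ Real.tan net.θ * (net.Pav h - z.1))}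

/-- The network constraints on a voltage matrix `V` and setpoints `p`, `q`. The traces are
those of products of two Hermitian matrices, so they are real numbers. -/
structure NetworkFeasible (V : NodeMatrix N) (p q : net.Vec) : Prop where
  psd : V.PosSemidef
  active : ∀ h : net.homes,
    (net.A h * V).trace.re = -net.Pload h + net.Pav h - p h
  reactive : ∀ h : net.homes, (net.B h * V).trace.re = -net.Qload h + q h
  pole_active : ∀ n ∈ net.poles, (net.A n * V).trace.re = 0
  pole_reactive : ∀ n ∈ net.poles, (net.B n * V).trace.re = 0
  voltage : ∀ n : Fin (N + 1),
    net.Vmin ^ 2 ≤ (M n * V).trace.re ∧ (M n * V).trace.re ≤ net.Vmax ^ 2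

/-- The inverter constraints on the setpoints. -/
def InverterFeasible (p q : net.Vec) : Prop := ∀ h, (p h, q h) ∈ net.region h

/-- The setpoints `(p, q)` that the network can support with some voltage matrix. -/
def networkSetpoints : Set (net.Vec × net.Vec) := {z | ∃ V, net.NetworkFeasible V z.1 z.2}

/-- The setpoints `(p, q)` that the inverters can realize. -/
def inverterSetpoints : Set (net.Vec × net.Vec) := {z | net.InverterFeasible z.1 z.2}

/-- Costs: the utility's objective `utility V p`, the customers' objectives `customer h P`, and
the weight of the group-sparsity regularizer. -/
structure Cost where
  utility : NodeMatrix N → net.Vec → ℝ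
  customer : net.homes → ℝ → ℝ
  weight : ℝ

variable {net}

namespace Cost

variable (c : net.Cost)

/-- The costs are convex: the utility's jointly in the Hermitian matrix `V` and in `p`, each
customer's in its curtailed power; and the weight of the regularizer is nonnegative. -/
structure IsConvex : Prop where
  utility : ConvexOn ℝ {x : NodeMatrix N × net.Vec | x.1.IsHermitian}
    (fun x => c.utility x.1 x.2)
  customer : ∀ h, ConvexOn ℝ Set.univ (c.customer h)
  weight : 0 ≤ c.weight

/-- The group-sparsity regularizer. -/
def G (p q : net.Vec) : ℝ := c.weight * ∑ h, ‖(!₂[p h, q h] : EuclideanSpace ℝ (Fin 2))‖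

/-- The total cost. -/
def C (V : NodeMatrix N) (p : net.Vec) : ℝ := c.utility V p + ∑ h, c.customer h (p h)

/-- The regularized cost minimized at the utility. -/
def Cbar (V : NodeMatrix N) (p q : net.Vec) : ℝ := c.utility V p + c.G p q

end Cost

/-- Feasible points `(V, p, q)` of the relaxed inverter dispatch problem. -/
def feasible (net : Feeder N) : Set (NodeMatrix N × net.Vec × net.Vec) :=
  {x | net.NetworkFeasible x.1 x.2.1 x.2.2 ∧ net.InverterFeasible x.2.1 x.2.2}

/-- `(V, p, q)` is an optimal solution of the relaxed (SDP) inverter dispatch problem. -/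
def IsOptimal (c : net.Cost) (V : NodeMatrix N) (p q : net.Vec) : Prop :=
  (V, p, q) ∈ net.feasible ∧
    IsMinOn (fun x : NodeMatrix N × net.Vec × net.Vec => c.C x.1 x.2.1 + c.G x.2.1 x.2.2)
      net.feasible (V, p, q)

/-- Feasible points `((V, p̄, q̄), (p, q))` of the consensus form of the problem. -/
def consensusFeasible (net : Feeder N) :
    Set ((NodeMatrix N × net.Vec × net.Vec) × (net.Vec × net.Vec)) :=
  {x | net.NetworkFeasible x.1.1 x.1.2.1 x.1.2.2 ∧ net.InverterFeasible x.2.1 x.2.2 ∧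
    (∀ h, x.1.2.1 h = x.2.1 h) ∧ (∀ h, x.1.2.2 h = x.2.2 h)}

/-- `(V, p̄, q̄, p, q)` is an optimal solution of the consensus form of the problem. -/
def IsConsensusOptimal (c : net.Cost) (V : NodeMatrix N) (pbar qbar p q : net.Vec) : Prop :=
  ((V, pbar, qbar), (p, q)) ∈ net.consensusFeasible ∧
    IsMinOn (fun x : (NodeMatrix N × net.Vec × net.Vec) × (net.Vec × net.Vec) =>
        c.Cbar x.1.1 x.1.2.1 x.1.2.2 + ∑ h, c.customer h (x.2.1 h))
      net.consensusFeasible ((V, pbar, qbar), (p, q))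

/-- The sequences generated by the algorithm: voltage matrices and setpoint copies at the
utility, setpoints of the customers, and dual variables. -/
structure Iterates (net : Feeder N) where
  V : ℕ → NodeMatrix N
  pbar : ℕ → net.Vec
  qbar : ℕ → net.Vec
  p : ℕ → net.Vec
  q : ℕ → net.Vec
  γ : ℕ → net.Vec
  μ : ℕ → net.Vec

namespace Iterates

variable (it : net.Iterates)

/-- The consensus-enforcing term in the utility's update. -/
def F (κ : ℝ) (i : ℕ) (pbar qbar : net.Vec) : ℝ :=
  ∑ h, (κ / 2 * (pbar h ^ 2 + qbar h ^ 2)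
    + pbar h * (it.γ i h - κ / 2 * it.pbar i h - κ / 2 * it.p i h)
    + qbar h * (it.μ i h - κ / 2 * it.qbar i h - κ / 2 * it.q i h))

/-- The objective in the update of customer `h`. -/
def customerObjective (c : net.Cost) (κ : ℝ) (i : ℕ) (h : net.homes) (z : ℝ × ℝ) : ℝ :=
  c.customer h z.1 + κ / 2 * (z.1 ^ 2 + z.2 ^ 2)
    - z.1 * (it.γ i h + κ / 2 * it.pbar i h + κ / 2 * it.p i h)
    - z.2 * (it.μ i h + κ / 2 * it.qbar i h + κ / 2 * it.q i h)

/-- The sequences are produced by the simplified ADMM steps with penalty `κ`, started from zero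
dual variables and from arbitrary setpoints and copies. -/
structure IsRun (c : net.Cost) (κ : ℝ) : Prop where
  γ_zero : ∀ h, it.γ 0 h = 0
  μ_zero : ∀ h, it.μ 0 h = 0
  utility_mem : ∀ i, net.NetworkFeasible (it.V (i + 1)) (it.pbar (i + 1)) (it.qbar (i + 1))
  utility_min : ∀ i, IsMinOn
    (fun x : NodeMatrix N × net.Vec × net.Vec =>
      c.Cbar x.1 x.2.1 x.2.2 + it.F κ i x.2.1 x.2.2)
    {x | net.NetworkFeasible x.1 x.2.1 x.2.2}
    (it.V (i + 1), it.pbar (i + 1), it.qbar (i + 1))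
  customer_mem : ∀ i h, (it.p (i + 1) h, it.q (i + 1) h) ∈ net.region h
  customer_min : ∀ i h, IsMinOn (it.customerObjective c κ i h) (net.region h)
    (it.p (i + 1) h, it.q (i + 1) h)
  γ_succ : ∀ i h, it.γ (i + 1) h = it.γ i h + κ / 2 * (it.pbar (i + 1) h - it.p (i + 1) h)
  μ_succ : ∀ i h, it.μ (i + 1) h = it.μ i h + κ / 2 * (it.qbar (i + 1) h - it.q (i + 1) h)

end Iterates

end Feeder

end

/-! The dispatch problem minimizes `f x + g y` over `x ∈ s`, `y ∈ t` subject to `l₁ x = l₂ y`: here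
`x` is the utility's triple, `y` the customers' setpoints, and the linear maps read off the two
copies of the setpoints. Both sets are convex and compact, and both costs are convex and continuous
there.

Compactness gives a primal optimum, and the relative-interior qualification gives a multiplier by
separating the point (zero perturbation, optimal value) from the strict epigraph of the perturbed
problem (`exists_multiplier`). So a saddle point exists.

Let `w i` be the average of the two copies. First-order optimality turns the two updates into saddle
inequalities at the multiplier `γ (i + 1)`, perturbed by `± κ • (w (i + 1) - w i)`. Adding them to
the inequalities of a saddle point with multiplier `γ'` and common setpoint `z` shows that `‖γ i -
γ'‖ ^ 2 + κ ^ 2 * ‖w i - z‖ ^ 2` decreases by at least the squared increments (`lyapunov_succ_le`).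
Hence the increments vanish, and every limit of the iterates along an ultrafilter is a saddle point
(`isConsensusSaddle_of_tendsto`). Taking such a limit as the reference point, the Lyapunov function
tends to zero along the ultrafilter, hence, being monotone, along the whole sequence. This makes the
duals and setpoints converge; cluster points of the voltage matrices are then handled by
compactness. -/

/-! ### First-order conditions and Lagrange multipliers. -/

section ConvexDuality

open Filter Topology

/-- The first-order optimality condition for a convex function plus a quadratic term that factors
through a linear map. -/
theorem ConvexOn.le_add_inner_of_isMinOn {W E : Type*} [AddCommGroup W] [Module ℝ W]
    [NormedAddCommGroup E] [InnerProductSpace ℝ E] {s : Set W} {f : W → ℝ}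
    (hf : ConvexOn ℝ s f) (l : W →ₗ[ℝ] E) (a : E) (κ : ℝ) {x y : W} (hx : x ∈ s) (hy : y ∈ s)
    (hmin : IsMinOn (fun w => f w + inner ℝ a (l w) + κ / 2 * ‖l w‖ ^ 2) s x) :
    f x ≤ f y + inner ℝ (a + κ • l x) (l y - l x) := by
  -- Compare `x` with the point at fraction `r` of the segment to `y` and divide by `r`; the
  -- quadratic term leaves an error of order `r`.
  have key : ∀ r ∈ Set.Ioo (0 : ℝ) 1,
      f x ≤ f y + inner ℝ (a + κ • l x) (l y - l x) + r * (κ / 2 * ‖l y - l x‖ ^ 2) := by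
    rintro r ⟨hr0, hr1⟩
    have hmem : (1 - r) • x + r • y ∈ s :=
      hf.1 hx hy (by linarith) hr0.le (by ring)
    have h1 := hmin hmem
    have h2 := hf.2 hx hy (by linarith : 0 ≤ 1 - r) hr0.le (by ring)
    have hl : l ((1 - r) • x + r • y) = l x + r • (l y - l x) := by
      simp only [map_add, map_smul]
      module
    simp only [Set.mem_ofPred_eq, hl] at h1
    rw [norm_add_sq_real, inner_add_right, inner_smul_right, inner_smul_right, norm_smul,
      mul_pow, Real.norm_eq_abs, sq_abs] at h1
    rw [inner_add_left, real_inner_smul_left]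
    simp only [smul_eq_mul] at h2
    nlinarith
  have hlim : Tendsto (fun r : ℝ =>
      f y + inner ℝ (a + κ • l x) (l y - l x) + r * (κ / 2 * ‖l y - l x‖ ^ 2)) (𝓝[>] 0)
      (𝓝 (f y + inner ℝ (a + κ • l x) (l y - l x) + 0 * (κ / 2 * ‖l y - l x‖ ^ 2))) :=
    ((continuous_const.add (continuous_id.mul continuous_const)).tendsto 0).mono_left
      nhdsWithin_le_nhds
  rw [zero_mul, add_zero] at hlim
  exact ge_of_tendsto hlim
    (eventually_of_mem (Ioo_mem_nhdsGT one_pos) key)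

/-- A point of the relative interior of a set can be moved a little in every direction of the
affine span. -/
theorem exists_ball_of_mem_intrinsicInterior {E : Type*} [NormedAddCommGroup E] [NormedSpace ℝ E]
    {s : Set E} {z : E} (hz : z ∈ intrinsicInterior ℝ s) :
    ∃ ε > 0, ∀ v ∈ vectorSpan ℝ s, ‖v‖ < ε → z + v ∈ s := by
  obtain ⟨y, hy, rfl⟩ := mem_intrinsicInterior.1 hz
  obtain ⟨ε, hε, hball⟩ := Metric.mem_nhds_iff.1 (mem_interior_iff_mem_nhds.1 hy)
  refine ⟨ε, hε, fun v hv hvn => ?_⟩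
  have hmem : (y : E) + v ∈ affineSpan ℝ s := by
    rw [add_comm]
    exact AffineSubspace.vadd_mem_of_mem_direction (by rwa [direction_affineSpan]) y.2
  have : (⟨(y : E) + v, hmem⟩ : affineSpan ℝ s) ∈ Metric.ball y ε := by
    simpa [Metric.mem_ball, Subtype.dist_eq, dist_eq_norm] using hvn
  exact hball this

/-- The sum of two subspaces of a finite-dimensional space admits linear selections of the
summands. -/
theorem exists_linearMap_decomposition {E : Type*} [AddCommGroup E] [Module ℝ E]
    (p q : Submodule ℝ E) :
    ∃ (a b : E →ₗ[ℝ] E), (∀ u, a u ∈ p) ∧ (∀ u, b u ∈ q) ∧ ∀ u ∈ p ⊔ q, a u + b u = u := by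
  let A : (p × q) →ₗ[ℝ] E := p.subtype.coprod q.subtype
  -- A linear section of the sum map over its range, then extended to all of `E`.
  obtain ⟨B, hB⟩ := A.rangeRestrict.exists_rightInverse_of_surjective A.range_rangeRestrict
  obtain ⟨C, hC⟩ := B.exists_extend
  refine ⟨p.subtype ∘ₗ LinearMap.fst ℝ p q ∘ₗ C, q.subtype ∘ₗ LinearMap.snd ℝ p q ∘ₗ C,
    fun u => by simp, fun u => by simp, fun u hu => ?_⟩
  have hu' : u ∈ LinearMap.range A := by
    simpa [A, LinearMap.range_coprod] using hu
  have h1 : C u = B ⟨u, hu'⟩ := LinearMap.congr_fun hC ⟨u, hu'⟩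
  have h2 := congrArg Subtype.val (LinearMap.congr_fun hB ⟨u, hu'⟩)
  simpa [A, h1] using h2

/-- Lagrange multipliers for a coupling constraint `l₁ x = l₂ y` between two convex problems with
bounded objectives, under the relative-interior constraint qualification. -/
theorem exists_multiplier {W₁ W₂ E : Type*} [AddCommGroup W₁] [Module ℝ W₁] [AddCommGroup W₂]
    [Module ℝ W₂] [NormedAddCommGroup E] [NormedSpace ℝ E] [FiniteDimensional ℝ E]
    {s : Set W₁} {t : Set W₂} {f : W₁ → ℝ} {g : W₂ → ℝ} (hf : ConvexOn ℝ s f)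
    (hg : ConvexOn ℝ t g) (hfb : BddAbove (f '' s)) (hgb : BddAbove (g '' t))
    (l₁ : W₁ →ₗ[ℝ] E) (l₂ : W₂ →ₗ[ℝ] E)
    (hcq : (intrinsicInterior ℝ (l₁ '' s) ∩ intrinsicInterior ℝ (l₂ '' t)).Nonempty) {m : ℝ}
    (hm : ∀ x ∈ s, ∀ y ∈ t, l₁ x = l₂ y → m ≤ f x + g y) :
    ∃ φ : E →L[ℝ] ℝ, ∀ x ∈ s, ∀ y ∈ t, m ≤ f x + g y + φ (l₁ x - l₂ y) := by
  obtain ⟨z, hz₁, hz₂⟩ := hcq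
  obtain ⟨ε₁, hε₁, hb₁⟩ := exists_ball_of_mem_intrinsicInterior hz₁
  obtain ⟨ε₂, hε₂, hb₂⟩ := exists_ball_of_mem_intrinsicInterior hz₂
  obtain ⟨Mf, hMf⟩ := hfb
  obtain ⟨Mg, hMg⟩ := hgb
  obtain ⟨a, b, ha, hb, hab⟩ :=
    exists_linearMap_decomposition (vectorSpan ℝ (l₁ '' s)) (vectorSpan ℝ (l₂ '' t))
  have hac : Continuous a := a.continuous_of_finiteDimensional
  have hbc : Continuous b := b.continuous_of_finiteDimensional
  -- The strict epigraph of the perturbed problem. Using `a u + b u` instead of `u` makes it a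
  -- pullback along a linear map, so it has interior even when the differences `l₁ x - l₂ y` span a
  -- proper subspace.
  let S : Set (E × ℝ) :=
    {v | ∃ x ∈ s, ∃ y ∈ t, l₁ x - l₂ y = a v.1 + b v.1 ∧ f x + g y < v.2}
  have hS : Convex ℝ S := by
    rintro ⟨u, r⟩ ⟨x, hx, y, hy, hxy, hr⟩ ⟨u', r'⟩ ⟨x', hx', y', hy', hxy', hr'⟩ α β hα hβ hαβ
    refine ⟨α • x + β • x', hf.1 hx hx' hα hβ hαβ, α • y + β • y', hg.1 hy hy' hα hβ hαβ, ?_, ?_⟩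
    · simp only [map_add, map_smul, Prod.smul_mk, Prod.mk_add_mk] at hxy hxy' ⊢
      calc _ = α • (l₁ x - l₂ y) + β • (l₁ x' - l₂ y') := by module
        _ = α • (a u + b u) + β • (a u' + b u') := by rw [hxy, hxy']
        _ = _ := by module
    · have h1 := hf.2 hx hx' hα hβ hαβ
      have h2 := hg.2 hy hy' hα hβ hαβ
      simp only [smul_eq_mul, Prod.smul_mk, Prod.mk_add_mk] at h1 h2 hr hr' ⊢
      rcases hα.eq_or_lt with rfl | hα
      · obtain rfl : β = 1 := by linarith
        linarith
      · nlinarith [mul_lt_mul_of_pos_left hr hα, mul_le_mul_of_nonneg_left hr'.le hβ]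
  have h0 : ((0 : E), m) ∉ S := by
    rintro ⟨x, hx, y, hy, hxy, hr⟩
    have := hm x hx y hy (by simpa [sub_eq_zero] using hxy)
    exact absurd hr this.not_gt
  have hopen : IsOpen {v : E × ℝ | ‖a v.1‖ < ε₁ ∧ ‖b v.1‖ < ε₂ ∧ Mf + Mg < v.2} :=
    (isOpen_lt (hac.comp continuous_fst).norm continuous_const).inter
      ((isOpen_lt (hbc.comp continuous_fst).norm continuous_const).inter
        (isOpen_lt continuous_const continuous_snd))
  -- Both `z + a u` and `z - b u` remain feasible for small `u`, and their difference is the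
  -- required perturbation; the upper bounds on `f` and `g` make one height work for all of them.
  have hsub : {v : E × ℝ | ‖a v.1‖ < ε₁ ∧ ‖b v.1‖ < ε₂ ∧ Mf + Mg < v.2} ⊆ S := by
    rintro ⟨u, r⟩ ⟨h1, h2, h3⟩
    obtain ⟨x, hx, hxz⟩ := hb₁ (a u) (ha u) h1
    obtain ⟨y, hy, hyz⟩ := hb₂ (-(b u)) (neg_mem (hb u)) (by rwa [norm_neg])
    refine ⟨x, hx, y, hy, ?_, ?_⟩
    · rw [hxz, hyz]; module
    · exact (add_le_add (hMf ⟨x, hx, rfl⟩) (hMg ⟨y, hy, rfl⟩)).trans_lt h3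
  have hint := interior_maximal hsub hopen
  obtain ⟨φ, hφ⟩ := geometric_hahn_banach_open_point hS.interior isOpen_interior
    (fun h => h0 (interior_subset h))
  have hp : ((0 : E), max m (Mf + Mg) + 1) ∈ interior S := hint
    ⟨by simpa using hε₁, by simpa using hε₂, by
      have := le_max_right m (Mf + Mg); simp only; linarith⟩
  have hcl : ∀ v ∈ S, φ v ≤ φ (0, m) := by
    intro v hv
    have hv' : v ∈ closure (interior S) := by
      rw [hS.closure_interior_eq_closure_of_nonempty_interior ⟨_, hp⟩]
      exact subset_closure hv
    exact closure_minimal (fun w hw => (hφ w hw).le)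
      (isClosed_le φ.continuous continuous_const) hv'
  have hsplit : ∀ (u : E) (r : ℝ), φ (u, r) = φ (u, 0) + r * φ (0, 1) := by
    intro u r
    have : ((u, r) : E × ℝ) = (u, 0) + r • ((0 : E), (1 : ℝ)) := by simp
    rw [this, map_add, map_smul, smul_eq_mul]
  -- The hyperplane is not vertical: an interior point of `S` lies straight above `(0, m)`.
  have hneg : φ (0, 1) < 0 := by
    have h1 := hφ _ hp
    rw [hsplit, hsplit 0 m] at h1
    have h2 := le_max_left m (Mf + Mg)
    by_contra! h3
    nlinarith
  refine ⟨(φ (0, 1))⁻¹ • φ.comp (ContinuousLinearMap.inl ℝ E ℝ), fun x hx y hy => ?_⟩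
  -- Subtract the common point `z` from both terms; on this sum of spans `a + b` is the identity.
  have hmem : l₁ x - l₂ y ∈ vectorSpan ℝ (l₁ '' s) ⊔ vectorSpan ℝ (l₂ '' t) := by
    obtain ⟨x₀, hx₀, hxz⟩ := intrinsicInterior_subset hz₁
    obtain ⟨y₀, hy₀, hyz⟩ := intrinsicInterior_subset hz₂
    have h1 := vsub_mem_vectorSpan ℝ (Set.mem_image_of_mem l₁ hx) (Set.mem_image_of_mem l₁ hx₀)
    have h2 := vsub_mem_vectorSpan ℝ (Set.mem_image_of_mem l₂ hy) (Set.mem_image_of_mem l₂ hy₀)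
    have := Submodule.add_mem_sup h1 (neg_mem h2)
    simpa [hxz, hyz] using this
  refine le_of_forall_pos_le_add fun ε hε => ?_
  have h1 := hcl (l₁ x - l₂ y, f x + g y + ε)
    ⟨x, hx, y, hy, (hab _ hmem).symm, by simpa using hε⟩
  rw [hsplit, hsplit 0 m] at h1
  have h00 : φ (0, 0) = 0 := map_zero φ
  rw [h00, zero_add] at h1
  simp only [_root_.smul_apply, ContinuousLinearMap.comp_apply,
    ContinuousLinearMap.inl_apply, smul_eq_mul]
  have h2 : φ (0, 1) * ((φ (0, 1))⁻¹ * φ (l₁ x - l₂ y, 0)) = φ (l₁ x - l₂ y, 0) := by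
    rw [mul_inv_cancel_left₀ hneg.ne]
  nlinarith

end ConvexDuality

/-! ### Convergence of consensus ADMM in an abstract setting. -/

section ConsensusADMM

open Filter Topology

/-- Saddle points of the problem of minimizing `f x + g y` over `x ∈ s` and `y ∈ t` subject to
`l₁ x = l₂ y`. -/
structure IsConsensusSaddle {W₁ W₂ E : Type*} [AddCommGroup W₁] [Module ℝ W₁] [AddCommGroup W₂]
    [Module ℝ W₂] [NormedAddCommGroup E] [InnerProductSpace ℝ E] (s : Set W₁) (t : Set W₂)
    (f : W₁ → ℝ) (g : W₂ → ℝ) (l₁ : W₁ →ₗ[ℝ] E) (l₂ : W₂ →ₗ[ℝ] E) (x : W₁) (y : W₂) (γ : E) :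
    Prop where
  left_mem : x ∈ s
  right_mem : y ∈ t
  consensus : l₁ x = l₂ y
  left_le : ∀ x' ∈ s, f x ≤ f x' + inner ℝ γ (l₁ x' - l₁ x)
  right_le : ∀ y' ∈ t, g y ≤ g y' - inner ℝ γ (l₂ y' - l₂ y)

/-- Sequences that satisfy the optimality conditions of the steps of consensus ADMM. -/
structure IsConsensusADMM {W₁ W₂ E : Type*} [AddCommGroup W₁] [Module ℝ W₁] [AddCommGroup W₂]
    [Module ℝ W₂] [NormedAddCommGroup E] [InnerProductSpace ℝ E] (s : Set W₁) (t : Set W₂)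
    (f : W₁ → ℝ) (g : W₂ → ℝ) (l₁ : W₁ →ₗ[ℝ] E) (l₂ : W₂ →ₗ[ℝ] E) (κ : ℝ)
    (x : ℕ → W₁) (y : ℕ → W₂) (γ w : ℕ → E) : Prop where
  average : ∀ i, w i = (1 / 2 : ℝ) • (l₁ (x i) + l₂ (y i))
  left_mem : ∀ i, x (i + 1) ∈ s
  right_mem : ∀ i, y (i + 1) ∈ t
  left_le : ∀ i, ∀ x' ∈ s, f (x (i + 1)) ≤
    f x' + inner ℝ (γ (i + 1) + κ • (w (i + 1) - w i)) (l₁ x' - l₁ (x (i + 1)))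
  right_le : ∀ i, ∀ y' ∈ t, g (y (i + 1)) ≤
    g y' - inner ℝ (γ (i + 1) - κ • (w (i + 1) - w i)) (l₂ y' - l₂ (y (i + 1)))
  dual : ∀ i, γ (i + 1) = γ i + (κ / 2) • (l₁ (x (i + 1)) - l₂ (y (i + 1)))

variable {W₁ W₂ E : Type*} [AddCommGroup W₁] [Module ℝ W₁] [AddCommGroup W₂]
  [Module ℝ W₂] [NormedAddCommGroup E] [InnerProductSpace ℝ E] {s : Set W₁} {t : Set W₂}
  {f : W₁ → ℝ} {g : W₂ → ℝ} {l₁ : W₁ →ₗ[ℝ] E} {l₂ : W₂ →ₗ[ℝ] E} {κ : ℝ}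
  {x : ℕ → W₁} {y : ℕ → W₂} {γ w : ℕ → E}

/-- A saddle point exists when the constraint qualification holds and the primal problem has a
solution. -/
theorem exists_isConsensusSaddle {F : Type*} [NormedAddCommGroup F] [NormedSpace ℝ F]
    [FiniteDimensional ℝ F] [CompleteSpace E] {l₁ : W₁ →ₗ[ℝ] F} {l₂ : W₂ →ₗ[ℝ] F} (e : F ≃L[ℝ] E)
    (hf : ConvexOn ℝ s f) (hg : ConvexOn ℝ t g) (hfb : BddAbove (f '' s)) (hgb : BddAbove (g '' t))
    (hcq : (intrinsicInterior ℝ (l₁ '' s) ∩ intrinsicInterior ℝ (l₂ '' t)).Nonempty)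
    {x : W₁} {y : W₂} (hx : x ∈ s) (hy : y ∈ t) (hxy : l₁ x = l₂ y)
    (hm : ∀ x' ∈ s, ∀ y' ∈ t, l₁ x' = l₂ y' → f x + g y ≤ f x' + g y') :
    ∃ γ : E, IsConsensusSaddle s t f g (e.toLinearEquiv.toLinearMap ∘ₗ l₁)
      (e.toLinearEquiv.toLinearMap ∘ₗ l₂) x y γ := by
  obtain ⟨φ, hφ⟩ := exists_multiplier hf hg hfb hgb l₁ l₂ hcq hm
  -- The multiplier is a functional on `F`; carried over by `e`, it becomes a vector of `E` by Riesz
  -- representation.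
  have hin : ∀ u v : F, inner ℝ ((InnerProductSpace.toDual ℝ E).symm (φ.comp (e.symm : E →L[ℝ] F)))
      (e u - e v) = φ (u - v) := fun u v => by
    rw [InnerProductSpace.toDual_symm_apply, ← map_sub]
    simp
  refine ⟨(InnerProductSpace.toDual ℝ E).symm (φ.comp (e.symm : E →L[ℝ] F)), hx, hy,
    by simp [hxy], fun x' hx' => ?_, fun y' hy' => ?_⟩
  · have h1 := hφ x' hx' y hy
    have h2 := hin (l₁ x') (l₁ x)
    rw [← hxy] at h1
    change f x ≤ f x' + inner ℝ _ (e (l₁ x') - e (l₁ x))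
    linarith
  · have h1 := hφ x hx y' hy'
    have h2 := hin (l₂ y') (l₂ y)
    rw [← neg_sub, map_neg, hxy] at h1
    change g y ≤ g y' - inner ℝ _ (e (l₂ y') - e (l₂ y))
    linarith

/-- A saddle point gives a solution of the primal problem. -/
theorem IsConsensusSaddle.isMinOn {x : W₁} {y : W₂} {γ : E}
    (h : IsConsensusSaddle s t f g l₁ l₂ x y γ) {x' : W₁} {y' : W₂} (hx' : x' ∈ s) (hy' : y' ∈ t)
    (hxy : l₁ x' = l₂ y') : f x + g y ≤ f x' + g y' := by
  have h1 := h.left_le x' hx'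
  have h2 := h.right_le y' hy'
  rw [hxy, h.consensus] at h1
  linarith

namespace IsConsensusADMM

/-- The optimality conditions hold if the steps are exact minimizations. -/
theorem of_isMinOn (hf : ConvexOn ℝ s f) (hg : ConvexOn ℝ t g)
    (hw : ∀ i, w i = (1 / 2 : ℝ) • (l₁ (x i) + l₂ (y i)))
    (hx : ∀ i, x (i + 1) ∈ s) (hy : ∀ i, y (i + 1) ∈ t)
    (hxmin : ∀ i, IsMinOn (fun x' => f x' + inner ℝ (γ i - κ • w i) (l₁ x') +
      κ / 2 * ‖l₁ x'‖ ^ 2) s (x (i + 1)))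
    (hymin : ∀ i, IsMinOn (fun y' => g y' + inner ℝ (-(γ i + κ • w i)) (l₂ y') +
      κ / 2 * ‖l₂ y'‖ ^ 2) t (y (i + 1)))
    (hγ : ∀ i, γ (i + 1) = γ i + (κ / 2) • (l₁ (x (i + 1)) - l₂ (y (i + 1)))) :
    IsConsensusADMM s t f g l₁ l₂ κ x y γ w where
  average := hw
  left_mem := hx
  right_mem := hy
  dual := hγ
  left_le i x' hx' := by
    have h := hf.le_add_inner_of_isMinOn l₁ _ κ (hx i) hx' (hxmin i)
    -- `l₁ (x (i + 1))` is the new average plus half the consensus gap, and `κ / 2` times that gap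
    -- is the dual increment.
    have he : γ i - κ • w i + κ • l₁ (x (i + 1)) = γ (i + 1) + κ • (w (i + 1) - w i) := by
      rw [hγ i, hw (i + 1)]; module
    rwa [he] at h
  right_le i y' hy' := by
    have h := hg.le_add_inner_of_isMinOn l₂ _ κ (hy i) hy' (hymin i)
    have he : -(γ i + κ • w i) + κ • l₂ (y (i + 1)) =
        -(γ (i + 1) - κ • (w (i + 1) - w i)) := by
      rw [hγ i, hw (i + 1)]; module
    rwa [he, inner_neg_left, ← sub_eq_add_neg] at h

/-- The Lyapunov function of consensus ADMM. -/
def lyapunov (κ : ℝ) (γ w : ℕ → E) (γ' z : E) (i : ℕ) : ℝ :=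
  ‖γ i - γ'‖ ^ 2 + κ ^ 2 * ‖w i - z‖ ^ 2

/-- In the sum of the two step inequalities and the two saddle inequalities all costs cancel. What
remains says that `⟪γ (i + 1) - γ', γ (i + 1) - γ i⟫ + κ ^ 2 * ⟪w (i + 1) - l₁ x', w (i + 1) - w i⟫`
is nonpositive, which is the cross term in the expansion of the squares. -/
theorem lyapunov_succ_le (hκ : 0 < κ) (h : IsConsensusADMM s t f g l₁ l₂ κ x y γ w)
    {x' : W₁} {y' : W₂} {γ' : E} (hs : IsConsensusSaddle s t f g l₁ l₂ x' y' γ') (i : ℕ) :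
    lyapunov κ γ w γ' (l₁ x') (i + 1) + ‖γ (i + 1) - γ i‖ ^ 2 + κ ^ 2 * ‖w (i + 1) - w i‖ ^ 2 ≤
      lyapunov κ γ w γ' (l₁ x') i := by
  have h1 := h.left_le i x' hs.left_mem
  have h2 := hs.left_le _ (h.left_mem i)
  have h3 := h.right_le i y' hs.right_mem
  have h4 := hs.right_le _ (h.right_mem i)
  rw [← hs.consensus] at h3 h4
  have hd : l₁ (x (i + 1)) - l₂ (y (i + 1)) = (2 / κ) • (γ (i + 1) - γ i) := by
    rw [h.dual i, add_sub_cancel_left, smul_smul]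
    rw [show 2 / κ * (κ / 2) = 1 by field_simp, one_smul]
  have hx : l₁ (x (i + 1)) = w (i + 1) + (1 / κ) • (γ (i + 1) - γ i) := by
    have : l₁ (x (i + 1)) = w (i + 1) + (1 / 2 : ℝ) • (l₁ (x (i + 1)) - l₂ (y (i + 1))) := by
      rw [h.average]; module
    rw [this, hd, smul_smul]
    congr 2; ring
  have hy : l₂ (y (i + 1)) = w (i + 1) - (1 / κ) • (γ (i + 1) - γ i) := by
    have : l₂ (y (i + 1)) = w (i + 1) - (1 / 2 : ℝ) • (l₁ (x (i + 1)) - l₂ (y (i + 1))) := by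
      rw [h.average]; module
    rw [this, hd, smul_smul]
    congr 2; ring
  rw [hx] at h1 h2
  rw [hy] at h3 h4
  have e1 : γ i - γ' = (γ (i + 1) - γ') - (γ (i + 1) - γ i) := by abel
  have e2 : w i - l₁ x' = (w (i + 1) - l₁ x') - (w (i + 1) - w i) := by abel
  unfold lyapunov
  rw [e1, e2, norm_sub_sq_real (γ (i + 1) - γ'), norm_sub_sq_real (w (i + 1) - l₁ x')]
  have e3 : γ (i + 1) = (γ (i + 1) - γ') + γ' := by abel
  generalize hA : γ (i + 1) - γ' = a at *
  generalize hB : γ (i + 1) - γ i = b at *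
  generalize hC : w (i + 1) - l₁ x' = c at *
  generalize hD : w (i + 1) - w i = d at *
  have e4 : l₁ x' - (w (i + 1) + (1 / κ) • b) = -(c + (1 / κ) • b) := by rw [← hC]; abel
  have e5 : w (i + 1) + (1 / κ) • b - l₁ x' = c + (1 / κ) • b := by rw [← hC]; abel
  have e6 : l₁ x' - (w (i + 1) - (1 / κ) • b) = -(c - (1 / κ) • b) := by rw [← hC]; abel
  have e7 : w (i + 1) - (1 / κ) • b - l₁ x' = c - (1 / κ) • b := by rw [← hC]; abel
  rw [e3, e4] at h1
  rw [e5] at h2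
  rw [e3, e6] at h3
  rw [e7] at h4
  simp only [inner_add_left, inner_sub_left, inner_add_right, inner_sub_right, inner_neg_right,
    real_inner_smul_left, real_inner_smul_right] at h1 h2 h3 h4
  have h5 : 2 * (1 / κ) * inner ℝ a b + 2 * κ * inner ℝ d c ≤ 0 := by linarith
  have h6 : κ * (2 * (1 / κ) * inner ℝ a b + 2 * κ * inner ℝ d c) ≤ 0 :=
    mul_nonpos_of_nonneg_of_nonpos hκ.le h5
  have h7 : κ * (2 * (1 / κ) * inner ℝ a b + 2 * κ * inner ℝ d c) =
      2 * inner ℝ a b + 2 * κ ^ 2 * inner ℝ c d := by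
    rw [real_inner_comm c d]; field_simp
  linarith

theorem lyapunov_antitone (hκ : 0 < κ) (h : IsConsensusADMM s t f g l₁ l₂ κ x y γ w)
    {x' : W₁} {y' : W₂} {γ' : E} (hs : IsConsensusSaddle s t f g l₁ l₂ x' y' γ') :
    Antitone (lyapunov κ γ w γ' (l₁ x')) :=
  antitone_nat_of_succ_le fun i => by
    have := h.lyapunov_succ_le hκ hs i
    have h1 : 0 ≤ ‖γ (i + 1) - γ i‖ ^ 2 := by positivity
    have h2 : 0 ≤ κ ^ 2 * ‖w (i + 1) - w i‖ ^ 2 := by positivity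
    linarith

/-- The increments of the dual variable and of the average vanish in the limit. -/
theorem tendsto_sub (hκ : 0 < κ) (h : IsConsensusADMM s t f g l₁ l₂ κ x y γ w)
    {x' : W₁} {y' : W₂} {γ' : E} (hs : IsConsensusSaddle s t f g l₁ l₂ x' y' γ') :
    Tendsto (fun i => γ (i + 1) - γ i) atTop (𝓝 0) ∧
      Tendsto (fun i => w (i + 1) - w i) atTop (𝓝 0) := by
  have hlim := tendsto_atTop_ciInf (h.lyapunov_antitone hκ hs)
    ⟨0, by rintro _ ⟨i, rfl⟩; unfold lyapunov; positivity⟩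
  -- A convergent sequence has vanishing successive differences, and these dominate the squared
  -- increments.
  have hdiff := hlim.sub (hlim.comp (tendsto_add_atTop_nat 1))
  rw [sub_self] at hdiff
  have hsum : ∀ i, ‖γ (i + 1) - γ i‖ ^ 2 + κ ^ 2 * ‖w (i + 1) - w i‖ ^ 2 ≤
      lyapunov κ γ w γ' (l₁ x') i - lyapunov κ γ w γ' (l₁ x') (i + 1) := fun i => by
    have := h.lyapunov_succ_le hκ hs i
    linarith
  constructor
  · rw [tendsto_zero_iff_norm_tendsto_zero]
    have : Tendsto (fun i => ‖γ (i + 1) - γ i‖ ^ 2) atTop (𝓝 0) :=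
      squeeze_zero (fun i => by positivity) (fun i => le_trans
        (le_add_of_nonneg_right (by positivity)) (hsum i)) hdiff
    simpa using this.sqrt
  · rw [tendsto_zero_iff_norm_tendsto_zero]
    have : Tendsto (fun i => (κ * ‖w (i + 1) - w i‖) ^ 2) atTop (𝓝 0) :=
      squeeze_zero (fun i => by positivity) (fun i => by
        rw [mul_pow]
        exact le_trans (le_add_of_nonneg_left (by positivity)) (hsum i)) hdiff
    have h2 : Tendsto (fun i => κ * ‖w (i + 1) - w i‖) atTop (𝓝 0) := by
      have h3 := this.sqrt
      rw [Real.sqrt_zero] at h3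
      exact h3.congr fun i => Real.sqrt_sq (by positivity)
    simpa [hκ.ne'] using h2.const_mul κ⁻¹

variable [TopologicalSpace W₁] [TopologicalSpace W₂]

/-- Limits of the iterates along an ultrafilter are saddle points. -/
theorem isConsensusSaddle_of_tendsto (hκ : 0 < κ) (h : IsConsensusADMM s t f g l₁ l₂ κ x y γ w)
    (hsc : IsClosed s) (htc : IsClosed t) (hf : ContinuousOn f s) (hg : ContinuousOn g t)
    (hl₁ : Continuous l₁) (hl₂ : Continuous l₂)
    (hγ : Tendsto (fun i => γ (i + 1) - γ i) atTop (𝓝 0))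
    (hw : Tendsto (fun i => w (i + 1) - w i) atTop (𝓝 0))
    {U : Filter ℕ} [U.NeBot] (hU : U ≤ atTop) {a : W₁} {b : W₂} {γ' : E}
    (hx : Tendsto (fun i => x (i + 1)) U (𝓝 a)) (hy : Tendsto (fun i => y (i + 1)) U (𝓝 b))
    (hγ' : Tendsto (fun i => γ (i + 1)) U (𝓝 γ')) :
    IsConsensusSaddle s t f g l₁ l₂ a b γ' := by
  have ha : a ∈ s := hsc.mem_of_tendsto hx (Eventually.of_forall h.left_mem)
  have hb : b ∈ t := htc.mem_of_tendsto hy (Eventually.of_forall h.right_mem)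
  have hfx : Tendsto (fun i => f (x (i + 1))) U (𝓝 (f a)) :=
    (hf a ha).tendsto.comp
      (tendsto_nhdsWithin_iff.2 ⟨hx, Eventually.of_forall h.left_mem⟩)
  have hgy : Tendsto (fun i => g (y (i + 1))) U (𝓝 (g b)) :=
    (hg b hb).tendsto.comp
      (tendsto_nhdsWithin_iff.2 ⟨hy, Eventually.of_forall h.right_mem⟩)
  have hlx := (hl₁.tendsto a).comp hx
  have hly := (hl₂.tendsto b).comp hy
  have hw' : Tendsto (fun i => κ • (w (i + 1) - w i)) U (𝓝 0) := by
    simpa using (hw.mono_left hU).const_smul κ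
  refine ⟨ha, hb, ?_, fun x' hx' => ?_, fun y' hy' => ?_⟩
  · have h1 : Tendsto (fun i => (2 / κ) • (γ (i + 1) - γ i)) U (𝓝 0) := by
      simpa using (hγ.mono_left hU).const_smul (2 / κ)
    have h2 := tendsto_nhds_unique (hlx.sub hly) (h1.congr fun i => ?_)
    · exact sub_eq_zero.1 h2
    · simp only [Function.comp_apply]
      rw [h.dual i, add_sub_cancel_left, smul_smul]
      rw [show 2 / κ * (κ / 2) = 1 by field_simp, one_smul]
  · have h1 := (hγ'.add hw').inner (𝕜 := ℝ) ((tendsto_const_nhds (x := l₁ x')).sub hlx)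
    rw [add_zero] at h1
    exact le_of_tendsto_of_tendsto hfx (tendsto_const_nhds.add h1)
      (Eventually.of_forall fun i => h.left_le i x' hx')
  · have h1 := (hγ'.sub hw').inner (𝕜 := ℝ) ((tendsto_const_nhds (x := l₂ y')).sub hly)
    rw [sub_zero] at h1
    exact le_of_tendsto_of_tendsto hgy (tendsto_const_nhds.sub h1)
      (Eventually.of_forall fun i => h.right_le i y' hy')

/-- Convergence of consensus ADMM over compact sets: if a saddle point exists, then the dual
variables and both copies of the coupling variable converge, the copies to the same limit, and all
cluster points of the iterates form saddle points with the dual limit. -/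
theorem exists_tendsto [FiniteDimensional ℝ E] [T2Space W₁] [T2Space W₂] (hκ : 0 < κ)
    (h : IsConsensusADMM s t f g l₁ l₂ κ x y γ w)
    (hsc : IsCompact s) (htc : IsCompact t) (hf : ContinuousOn f s) (hg : ContinuousOn g t)
    (hl₁ : Continuous l₁) (hl₂ : Continuous l₂)
    {x' : W₁} {y' : W₂} {γ' : E} (hs : IsConsensusSaddle s t f g l₁ l₂ x' y' γ') :
    ∃ (a : W₁) (b : W₂) (ν : E), IsConsensusSaddle s t f g l₁ l₂ a b ν ∧
      Tendsto (fun i => l₁ (x i)) atTop (𝓝 (l₁ a)) ∧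
      Tendsto (fun i => l₂ (y i)) atTop (𝓝 (l₂ b)) ∧ Tendsto γ atTop (𝓝 ν) ∧
      ∀ (U : Ultrafilter ℕ) (a' : W₁) (b' : W₂), (U : Filter ℕ) ≤ atTop →
        Tendsto (fun i => x (i + 1)) U (𝓝 a') → Tendsto (fun i => y (i + 1)) U (𝓝 b') →
        IsConsensusSaddle s t f g l₁ l₂ a' b' ν := by
  obtain ⟨hγ, hw⟩ := h.tendsto_sub hκ hs
  have hbd : ∀ i, ‖γ i - γ'‖ ^ 2 ≤ lyapunov κ γ w γ' (l₁ x') 0 := fun i =>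
    le_trans (le_add_of_nonneg_right (by positivity))
      (h.lyapunov_antitone hκ hs (Nat.zero_le i))
  have hball : ∀ i, γ i ∈ Metric.closedBall γ' (√(lyapunov κ γ w γ' (l₁ x') 0)) := fun i => by
    rw [Metric.mem_closedBall, dist_eq_norm]
    exact Real.le_sqrt_of_sq_le (hbd i)
  have := FiniteDimensional.proper_real E
  let U : Ultrafilter ℕ := Ultrafilter.of atTop
  have hU : (U : Filter ℕ) ≤ atTop := Ultrafilter.of_le _
  -- The shift by one skips the initial point, which is arbitrary and need not lie in `s`.
  obtain ⟨a, -, ha⟩ := hsc.ultrafilter_le_nhds (U.map fun i => x (i + 1))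
    (tendsto_principal.2 (Eventually.of_forall h.left_mem))
  obtain ⟨b, -, hb⟩ := htc.ultrafilter_le_nhds (U.map fun i => y (i + 1))
    (tendsto_principal.2 (Eventually.of_forall h.right_mem))
  obtain ⟨ν, -, hν⟩ := (isCompact_closedBall γ' _).ultrafilter_le_nhds
    (U.map fun i => γ (i + 1)) (tendsto_principal.2 (Eventually.of_forall fun i => hball (i + 1)))
  have ha : Tendsto (fun i => x (i + 1)) U (𝓝 a) := ha
  have hb : Tendsto (fun i => y (i + 1)) U (𝓝 b) := hb
  have hν : Tendsto (fun i => γ (i + 1)) U (𝓝 ν) := hν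
  have hsad := h.isConsensusSaddle_of_tendsto hκ hsc.isClosed htc.isClosed hf hg hl₁ hl₂ hγ hw hU
    ha hb hν
  have hwU : Tendsto (fun i => w (i + 1)) U (𝓝 (l₁ a)) := by
    have h1 := (((hl₁.tendsto a).comp ha).add ((hl₂.tendsto b).comp hb)).const_smul (1 / 2 : ℝ)
    rw [← hsad.consensus, show (1 / 2 : ℝ) • (l₁ a + l₁ a) = l₁ a by module] at h1
    exact h1.congr fun i => (h.average _).symm
  have hΦU : Tendsto (fun i => lyapunov κ γ w ν (l₁ a) (i + 1)) U (𝓝 0) := by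
    have h1 := ((hν.sub_const ν).norm.pow 2).add
      (((hwU.sub_const (l₁ a)).norm.pow 2).const_mul (κ ^ 2))
    simpa [lyapunov] using h1
  have hlim := tendsto_atTop_ciInf (h.lyapunov_antitone hκ hsad)
    ⟨0, by rintro _ ⟨i, rfl⟩; unfold lyapunov; positivity⟩
  -- The full limit exists by monotonicity, relative to the new saddle point; the ultrafilter
  -- identifies it as zero.
  have hΦ : Tendsto (lyapunov κ γ w ν (l₁ a)) atTop (𝓝 0) := by
    rwa [tendsto_nhds_unique ((hlim.comp (tendsto_add_atTop_nat 1)).mono_left hU) hΦU] at hlim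
  have hγlim : Tendsto γ atTop (𝓝 ν) := by
    rw [tendsto_iff_norm_sub_tendsto_zero]
    have : Tendsto (fun i => ‖γ i - ν‖ ^ 2) atTop (𝓝 0) :=
      squeeze_zero (fun i => by positivity)
        (fun i => le_add_of_nonneg_right (by positivity)) hΦ
    simpa using this.sqrt
  have hwlim : Tendsto w atTop (𝓝 (l₁ a)) := by
    rw [tendsto_iff_norm_sub_tendsto_zero]
    have : Tendsto (fun i => κ ^ 2 * ‖w i - l₁ a‖ ^ 2) atTop (𝓝 0) :=
      squeeze_zero (fun i => by positivity)
        (fun i => le_add_of_nonneg_left (by positivity)) hΦ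
    have h2 := (this.const_mul (κ ^ 2)⁻¹).sqrt
    simpa [hκ.ne'] using h2
  have hdiff : Tendsto (fun i => (1 / κ) • (γ (i + 1) - γ i)) atTop (𝓝 0) := by
    simpa using hγ.const_smul (1 / κ)
  -- Adding or subtracting this half-gap turns the average into one or the other copy, so both
  -- copies inherit its limit.
  have hhalf : ∀ i, (1 / κ) • (γ (i + 1) - γ i) =
      (1 / 2 : ℝ) • (l₁ (x (i + 1)) - l₂ (y (i + 1))) := fun i => by
    rw [h.dual i, add_sub_cancel_left, smul_smul]
    congr 1; field_simp
  have hw1 := hwlim.comp (tendsto_add_atTop_nat 1)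
  refine ⟨a, b, ν, hsad, ?_, ?_, hγlim, fun U' a' b' hU' ha' hb' => ?_⟩
  · rw [← tendsto_add_atTop_iff_nat 1]
    have h1 := hw1.add hdiff
    rw [add_zero] at h1
    refine h1.congr fun i => ?_
    rw [hhalf, Function.comp_apply, h.average]
    module
  · rw [← tendsto_add_atTop_iff_nat 1, ← hsad.consensus]
    have h1 := hw1.sub hdiff
    rw [sub_zero] at h1
    refine h1.congr fun i => ?_
    rw [hhalf, Function.comp_apply, h.average]
    module
  · exact h.isConsensusSaddle_of_tendsto hκ hsc.isClosed htc.isClosed hf hg hl₁ hl₂ hγ hw hU'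
      ha' hb' ((hγlim.comp (tendsto_add_atTop_nat 1)).mono_left hU')

end IsConsensusADMM

end ConsensusADMM

/-! ### Compactness of positive semidefinite matrices with bounded diagonal. -/

section Matrices

open Filter Topology

theorem Matrix.isClosed_setOf_posSemidef {n : Type*} [Fintype n] :
    IsClosed {V : Matrix n n ℂ | V.PosSemidef} := by
  simp only [Matrix.posSemidef_iff_dotProduct_mulVec, Set.ofPred_and, Set.ofPred_forall]
  refine IsClosed.inter (isClosed_eq (by fun_prop) continuous_id) (isClosed_iInter fun x => ?_)
  exact isClosed_le continuous_const (by fun_prop)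

/-- The modulus of an entry of a positive semidefinite matrix with diagonal at most `c` is at most
`c`. -/
theorem Matrix.PosSemidef.norm_apply_le {n : Type*} [Fintype n] {V : Matrix n n ℂ}
    (hV : V.PosSemidef) {c : ℝ} (hc : ∀ i, (V i i).re ≤ c) (i j : n) : ‖V i j‖ ≤ c := by
  have hdiag : ∀ k, 0 ≤ V k k := fun k => hV.diag_nonneg
  have hre : ∀ k, V k k = ((V k k).re : ℂ) := fun k =>
    (Complex.ext rfl (by simpa using ((Complex.nonneg_iff.1 (hdiag k)).2).symm))
  have h0 : ∀ k, 0 ≤ (V k k).re := fun k => (Complex.nonneg_iff.1 (hdiag k)).1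
  -- The 2 × 2 minor bounds `‖V i j‖ ^ 2` by the product of two diagonal entries; for `i = j` the
  -- index is repeated and the argument still holds.
  have hdet := (hV.submatrix ![i, j]).det_nonneg
  rw [Matrix.det_fin_two] at hdet
  simp only [Matrix.submatrix_apply, Matrix.cons_val_zero, Matrix.cons_val_one] at hdet
  rw [← hV.isHermitian.apply j i, hre i, hre j, Complex.star_def, Complex.mul_conj,
    Complex.normSq_eq_norm_sq] at hdet
  have h1 : 0 ≤ (V i i).re * (V j j).re - ‖V i j‖ ^ 2 := by exact_mod_cast hdet
  refine abs_le_of_sq_le_sq' ?_ ((h0 i).trans (hc i)) |>.2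
  nlinarith [hc i, hc j, h0 i, h0 j]

/-- The positive semidefinite matrices with bounded diagonal form a compact set. -/
theorem Matrix.isCompact_setOf_posSemidef {n : Type*} [Fintype n] (c : ℝ) :
    IsCompact {V : Matrix n n ℂ | V.PosSemidef ∧ ∀ i, (V i i).re ≤ c} := by
  have hbox : IsCompact (Set.univ.pi fun _ => Set.univ.pi fun _ => Metric.closedBall 0 c :
      Set (Matrix n n ℂ)) :=
    isCompact_univ_pi fun _ => isCompact_univ_pi fun _ => isCompact_closedBall 0 c
  have hdiag : IsClosed {V : Matrix n n ℂ | ∀ i, (V i i).re ≤ c} := by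
    simp only [Set.ofPred_forall]
    exact isClosed_iInter fun i => isClosed_le
      (Complex.continuous_re.comp (continuous_id.matrix_elem i i)) continuous_const
  refine hbox.of_isClosed_subset (Matrix.isClosed_setOf_posSemidef.inter hdiag) ?_
  rintro V ⟨hV, hc⟩ i - j -
  simpa using hV.norm_apply_le hc i j

end Matrices

/-! ### Convexity, compactness and continuity of the dispatch data. -/

namespace Feeder

open Filter Topology

variable {N : ℕ} {net : Feeder N}

theorem trace_M_mul (n : Fin (N + 1)) (V : NodeMatrix N) : (M n * V).trace = V n n := by
  simp [M, Matrix.vecMulVec_mul, Matrix.trace_vecMulVec]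

theorem trace_re_combo (A V W : NodeMatrix N) (a b : ℝ) :
    (A * (a • V + b • W)).trace.re = a * (A * V).trace.re + b * (A * W).trace.re := by
  simp [Matrix.mul_add]

theorem continuous_trace_re (A : NodeMatrix N) :
    Continuous fun V : NodeMatrix N => (A * V).trace.re :=
  Complex.continuous_re.comp (continuous_const.matrix_mul continuous_id).matrix_trace

/-- The network constraints as a set. -/
def networkSet (net : Feeder N) : Set (NodeMatrix N × net.Vec × net.Vec) :=
  {x | net.NetworkFeasible x.1 x.2.1 x.2.2}

theorem convex_networkSet : Convex ℝ net.networkSet := by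
  rintro ⟨V, p, q⟩ hx ⟨V', p', q'⟩ hx' a b ha hb hab
  simp only [networkSet, Set.mem_ofPred_eq] at hx hx'
  have hb' : b = 1 - a := by linarith
  refine ⟨(hx.psd.smul ha).add (hx'.psd.smul hb), fun h => ?_, fun h => ?_, fun n hn => ?_,
    fun n hn => ?_, fun n => ?_⟩ <;>
    simp only [Prod.smul_mk, Prod.mk_add_mk, trace_re_combo, Pi.add_apply, Pi.smul_apply,
      smul_eq_mul]
  · rw [hx.active, hx'.active, hb']; ring
  · rw [hx.reactive, hx'.reactive, hb']; ring
  · rw [hx.pole_active n hn, hx'.pole_active n hn]; ring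
  · rw [hx.pole_reactive n hn, hx'.pole_reactive n hn]; ring
  · obtain ⟨h1, h2⟩ := hx.voltage n
    obtain ⟨h3, h4⟩ := hx'.voltage n
    subst hb'
    constructor <;> nlinarith

theorem isClosed_networkSet : IsClosed net.networkSet := by
  have hset : net.networkSet = {x | x.1.PosSemidef} ∩
      ({x | ∀ h : net.homes, (net.A h * x.1).trace.re = -net.Pload h + net.Pav h - x.2.1 h} ∩
      ({x | ∀ h : net.homes, (net.B h * x.1).trace.re = -net.Qload h + x.2.2 h} ∩
      ({x | ∀ n, n ∈ net.poles → (net.A n * x.1).trace.re = 0} ∩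
      ({x | ∀ n, n ∈ net.poles → (net.B n * x.1).trace.re = 0} ∩
      {x | ∀ n : Fin (N + 1), net.Vmin ^ 2 ≤ (M n * x.1).trace.re ∧
        (M n * x.1).trace.re ≤ net.Vmax ^ 2})))) := by
    ext x
    exact ⟨fun h => ⟨h.psd, h.active, h.reactive, h.pole_active, h.pole_reactive, h.voltage⟩,
      fun ⟨h1, h2, h3, h4, h5, h6⟩ => ⟨h1, h2, h3, h4, h5, h6⟩⟩
  have htr : ∀ A : NodeMatrix N, Continuous
      fun x : NodeMatrix N × net.Vec × net.Vec => (A * x.1).trace.re :=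
    fun A => (continuous_trace_re A).comp continuous_fst
  rw [hset]
  simp only [Set.ofPred_forall, Set.ofPred_and]
  refine (Matrix.isClosed_setOf_posSemidef.preimage continuous_fst).inter
    (IsClosed.inter ?_ (IsClosed.inter ?_ (IsClosed.inter ?_ (IsClosed.inter ?_ ?_))))
  · exact isClosed_iInter fun h => isClosed_eq (htr _) (by fun_prop)
  · exact isClosed_iInter fun h => isClosed_eq (htr _) (by fun_prop)
  · exact isClosed_iInter fun n => isClosed_iInter fun _ => isClosed_eq (htr _) continuous_const
  · exact isClosed_iInter fun n => isClosed_iInter fun _ => isClosed_eq (htr _) continuous_const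
  · exact isClosed_iInter fun n => (isClosed_le continuous_const (htr _)).inter
      (isClosed_le (htr _) continuous_const)

/-- The power balances make the setpoints continuous functions of `V`, and the upper voltage limits
bound the diagonal of `V`. -/
theorem isCompact_networkSet : IsCompact net.networkSet := by
  let Φ : NodeMatrix N → NodeMatrix N × net.Vec × net.Vec := fun V =>
    (V, fun h => -net.Pload h + net.Pav h - (net.A h * V).trace.re,
      fun h => net.Qload h + (net.B h * V).trace.re)
  have hΦ : Continuous Φ := by
    refine continuous_id.prodMk (.prodMk (continuous_pi fun h => ?_) (continuous_pi fun h => ?_))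
    · exact continuous_const.sub (continuous_trace_re _)
    · exact continuous_const.add (continuous_trace_re _)
  refine ((Matrix.isCompact_setOf_posSemidef (net.Vmax ^ 2)).image hΦ).of_isClosed_subset
    isClosed_networkSet ?_
  rintro ⟨V, p, q⟩ hx
  simp only [networkSet, Set.mem_ofPred_eq] at hx
  refine ⟨V, ⟨hx.psd, fun i => ?_⟩, ?_⟩
  · simpa [trace_M_mul] using (hx.voltage i).2
  · simp only [Φ, Prod.mk.injEq, true_and]
    constructor <;> funext h
    · rw [hx.active]; ring
    · rw [hx.reactive]; ring

theorem convex_region (h : net.homes) : Convex ℝ (net.region h) := by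
  rintro ⟨P, Q⟩ ⟨⟨h1, h2⟩, h3, h4⟩ ⟨P', Q'⟩ ⟨⟨h1', h2'⟩, h3', h4'⟩ a b ha hb hab
  obtain rfl : b = 1 - a := by linarith
  simp only at h1 h2 h3 h4 h1' h2' h3' h4'
  refine ⟨⟨?_, ?_⟩, ?_, fun hθ => ?_⟩ <;>
    simp only [Prod.smul_mk, Prod.mk_add_mk, smul_eq_mul]
  · positivity
  · nlinarith
  · have e1 : (a * Q + (1 - a) * Q') ^ 2 =
        a * Q ^ 2 + (1 - a) * Q' ^ 2 - a * (1 - a) * (Q - Q') ^ 2 := by ring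
    have e2 : (net.Pav h - (a * P + (1 - a) * P')) ^ 2 =
        a * (net.Pav h - P) ^ 2 + (1 - a) * (net.Pav h - P') ^ 2
          - a * (1 - a) * (P - P') ^ 2 := by ring
    have e3 : 0 ≤ a * (1 - a) * (Q - Q') ^ 2 := by positivity
    have e4 : 0 ≤ a * (1 - a) * (P - P') ^ 2 := by positivity
    rw [e1, e2]
    nlinarith [mul_le_mul_of_nonneg_left h3 ha, mul_le_mul_of_nonneg_left h3' hb]
  · calc |a * Q + (1 - a) * Q'| ≤ |a * Q| + |(1 - a) * Q'| := abs_add_le _ _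
      _ = a * |Q| + (1 - a) * |Q'| := by rw [abs_mul, abs_mul, abs_of_nonneg ha, abs_of_nonneg hb]
      _ ≤ a * (Real.tan net.θ * (net.Pav h - P)) +
          (1 - a) * (Real.tan net.θ * (net.Pav h - P')) :=
        add_le_add (mul_le_mul_of_nonneg_left (h4 hθ) ha)
          (mul_le_mul_of_nonneg_left (h4' hθ) hb)
      _ = _ := by ring

theorem isClosed_region (h : net.homes) : IsClosed (net.region h) := by
  simp only [region, Set.ofPred_and, Set.ofPred_forall]
  refine ((isClosed_le (by fun_prop) (by fun_prop)).inter
    (isClosed_le (by fun_prop) (by fun_prop))).inter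
    ((isClosed_le (by fun_prop) (by fun_prop)).inter (isClosed_iInter fun _ =>
      isClosed_le (by fun_prop) (by fun_prop)))

theorem convex_inverterSetpoints : Convex ℝ net.inverterSetpoints :=
  fun _ hx _ hy _ _ ha hb hab h => convex_region h (hx h) (hy h) ha hb hab

theorem isCompact_inverterSetpoints : IsCompact net.inverterSetpoints := by
  have hbox : IsCompact
      ((Set.univ.pi fun h => Set.Icc 0 (net.Pav h)) ×ˢ
        (Set.univ.pi fun h => Set.Icc (-|net.rating h|) |net.rating h|) :
        Set (net.Vec × net.Vec)) :=
    (isCompact_univ_pi fun _ => isCompact_Icc).prod (isCompact_univ_pi fun _ => isCompact_Icc)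
  refine hbox.of_isClosed_subset ?_ ?_
  · have : net.inverterSetpoints = ⋂ h, (fun z : net.Vec × net.Vec => (z.1 h, z.2 h)) ⁻¹'
        net.region h := by
      ext z; simp [inverterSetpoints, InverterFeasible]
    rw [this]
    exact isClosed_iInter fun h => (isClosed_region h).preimage (by fun_prop)
  · intro z hz
    refine ⟨fun h _ => (hz h).1, fun h _ => ?_⟩
    -- The apparent-power disc alone bounds the reactive power, whatever the angle.
    have := (hz h).2.1
    exact abs_le.1 (sq_le_sq.1 (by simp only at this; nlinarith [sq_nonneg (net.Pav h - z.1 h)]))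

namespace Cost

variable {c : net.Cost}

/-- The regularized utility cost as a function on triples. -/
noncomputable def utilityCost (c : net.Cost) (x : NodeMatrix N × net.Vec × net.Vec) : ℝ :=
  c.Cbar x.1 x.2.1 x.2.2

/-- The total customer cost as a function on setpoints. -/
noncomputable def customerCost (c : net.Cost) (z : net.Vec × net.Vec) : ℝ := ∑ h, c.customer h (z.1 h)

theorem convexOn_G (hc : c.IsConvex) :
    ConvexOn ℝ Set.univ fun z : net.Vec × net.Vec => c.G z.1 z.2 := by
  refine ⟨convex_univ, fun z _ z' _ a b ha hb _ => ?_⟩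
  have key : ∀ h, ‖(!₂[(a • z + b • z').1 h, (a • z + b • z').2 h] : EuclideanSpace ℝ (Fin 2))‖ ≤
      a * ‖(!₂[z.1 h, z.2 h] : EuclideanSpace ℝ (Fin 2))‖ +
      b * ‖(!₂[z'.1 h, z'.2 h] : EuclideanSpace ℝ (Fin 2))‖ := fun h => by
    have e : (!₂[(a • z + b • z').1 h, (a • z + b • z').2 h] : EuclideanSpace ℝ (Fin 2)) =
        a • !₂[z.1 h, z.2 h] + b • !₂[z'.1 h, z'.2 h] := by
      ext i; fin_cases i <;> simp
    rw [e]
    refine (norm_add_le _ _).trans_eq ?_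
    rw [norm_smul, norm_smul, Real.norm_of_nonneg ha, Real.norm_of_nonneg hb]
  have hsum := Finset.sum_le_sum fun h (_ : h ∈ Finset.univ) => key h
  rw [Finset.sum_add_distrib, ← Finset.mul_sum, ← Finset.mul_sum] at hsum
  have := mul_le_mul_of_nonneg_left hsum hc.weight
  simp only [G, smul_eq_mul]
  linarith

/-- The utility cost extended to all matrices through their Hermitian parts. -/
theorem exists_convex_extension (hc : c.IsConvex) :
    ∃ u : NodeMatrix N × net.Vec → ℝ, ConvexOn ℝ Set.univ u ∧
      ∀ V p, V.IsHermitian → u (V, p) = c.utility V p := by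
  let L : NodeMatrix N × net.Vec →ₗ[ℝ] NodeMatrix N × net.Vec :=
    LinearMap.prodMap ((selfAdjoint.submodule ℝ (NodeMatrix N)).subtype ∘ₗ
      selfAdjointPart ℝ) LinearMap.id
  refine ⟨_, (hc.utility.comp_linearMap L).subset (fun x _ => ?_) convex_univ, fun V p hV => ?_⟩
  · exact (selfAdjointPart ℝ x.1).2
  · have : (selfAdjointPart ℝ V : NodeMatrix N) = V :=
      IsSelfAdjoint.coe_selfAdjointPart_apply ℝ hV
    change c.utility (selfAdjointPart ℝ V : NodeMatrix N) p = _
    rw [this]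

theorem convexOn_utilityCost (hc : c.IsConvex) : ConvexOn ℝ net.networkSet c.utilityCost := by
  obtain ⟨u, hu, huv⟩ := exists_convex_extension hc
  have h1 := (hu.comp_linearMap ((LinearMap.fst ℝ (NodeMatrix N) (net.Vec × net.Vec)).prod
    (LinearMap.fst ℝ net.Vec net.Vec ∘ₗ LinearMap.snd ℝ _ _))).add
    ((convexOn_G hc).comp_linearMap (LinearMap.snd ℝ (NodeMatrix N) (net.Vec × net.Vec)))
  refine (h1.subset (Set.subset_univ _) convex_networkSet).congr fun x hx => ?_
  change u (x.1, x.2.1) + c.G x.2.1 x.2.2 = _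
  rw [huv _ _ (NetworkFeasible.psd hx).isHermitian]
  rfl

/-- A finite convex function on a whole finite-dimensional real space is continuous. The Hermitian
matrices form only a subspace, hence the detour through the extension. -/
theorem continuousOn_utilityCost (hc : c.IsConvex) :
    ContinuousOn c.utilityCost net.networkSet := by
  obtain ⟨u, hu, huv⟩ := exists_convex_extension hc
  have hcont : Continuous u := by
    -- An auxiliary norm, used only to derive continuity.
    let : NormedAddCommGroup (NodeMatrix N) := Matrix.normedAddCommGroup
    let : NormedSpace ℝ (NodeMatrix N) := Matrix.normedSpace
    exact hu.locallyLipschitz.continuous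
  have hG := (convexOn_G hc).locallyLipschitz.continuous
  have h1 : Continuous fun x : NodeMatrix N × net.Vec × net.Vec =>
      u (x.1, x.2.1) + c.G x.2.1 x.2.2 :=
    (hcont.comp (continuous_fst.prodMk (continuous_fst.comp continuous_snd))).add
      (hG.comp continuous_snd)
  refine h1.continuousOn.congr fun x hx => ?_
  change _ = u (x.1, x.2.1) + c.G x.2.1 x.2.2
  rw [huv _ _ (NetworkFeasible.psd hx).isHermitian]
  rfl

theorem convexOn_customerCost (hc : c.IsConvex) : ConvexOn ℝ net.inverterSetpoints
    c.customerCost := by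
  refine ⟨convex_inverterSetpoints, fun z _ z' _ a b ha hb hab => ?_⟩
  simp only [customerCost, Finset.smul_sum, ← Finset.sum_add_distrib]
  exact Finset.sum_le_sum fun h _ =>
    (hc.customer h).2 (Set.mem_univ _) (Set.mem_univ _) ha hb hab

theorem continuous_customerCost (hc : c.IsConvex) : Continuous c.customerCost :=
  continuous_finsetSum _ fun h _ => (hc.customer h).locallyLipschitz.continuous.comp
    ((continuous_apply h).comp continuous_fst)

end Cost

end Feeder

/-! ### The dispatch problem and its algorithm as an instance of the abstract scheme. -/

namespace Feeder

open Filter Topology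

variable {N : ℕ} {net : Feeder N}

/-- The setpoints as a Euclidean vector. -/
noncomputable def setpointEquiv (net : Feeder N) :
    (net.Vec × net.Vec) ≃L[ℝ] EuclideanSpace ℝ (net.homes ⊕ net.homes) :=
  ((LinearEquiv.sumArrowLequivProdArrow net.homes net.homes ℝ ℝ).symm.trans
    (WithLp.linearEquiv 2 ℝ (net.homes ⊕ net.homes → ℝ)).symm).toContinuousLinearEquiv

theorem setpointEquiv_inl (z : net.Vec × net.Vec) (h : net.homes) :
    net.setpointEquiv z (Sum.inl h) = z.1 h := rfl

theorem setpointEquiv_inr (z : net.Vec × net.Vec) (h : net.homes) :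
    net.setpointEquiv z (Sum.inr h) = z.2 h := rfl

theorem inner_setpointEquiv (v : EuclideanSpace ℝ (net.homes ⊕ net.homes))
    (z : net.Vec × net.Vec) : inner ℝ v (net.setpointEquiv z) =
      ∑ h, (v (Sum.inl h) * z.1 h + v (Sum.inr h) * z.2 h) := by
  simp [PiLp.inner_apply, setpointEquiv_inl, setpointEquiv_inr, Finset.sum_add_distrib, mul_comm]

theorem norm_sq_setpointEquiv (z : net.Vec × net.Vec) :
    ‖net.setpointEquiv z‖ ^ 2 = ∑ h, (z.1 h ^ 2 + z.2 h ^ 2) := by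
  rw [← real_inner_self_eq_norm_sq, inner_setpointEquiv]
  simp only [setpointEquiv_inl, setpointEquiv_inr, sq]

/-- The copies of the setpoints at the utility. -/
noncomputable def utilitySetpoint (net : Feeder N) :
    NodeMatrix N × net.Vec × net.Vec →ₗ[ℝ] EuclideanSpace ℝ (net.homes ⊕ net.homes) :=
  net.setpointEquiv.toLinearEquiv.toLinearMap ∘ₗ LinearMap.snd ℝ _ _

/-- The setpoints of the customers. -/
noncomputable def customerSetpoint (net : Feeder N) :
    net.Vec × net.Vec →ₗ[ℝ] EuclideanSpace ℝ (net.homes ⊕ net.homes) :=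
  net.setpointEquiv.toLinearEquiv.toLinearMap ∘ₗ LinearMap.id

theorem utilitySetpoint_apply (x : NodeMatrix N × net.Vec × net.Vec) :
    net.utilitySetpoint x = net.setpointEquiv x.2 := rfl

theorem customerSetpoint_apply (z : net.Vec × net.Vec) :
    net.customerSetpoint z = net.setpointEquiv z := rfl

theorem isConsensusOptimal_iff (c : net.Cost) (V : NodeMatrix N) (pbar qbar p q : net.Vec) :
    IsConsensusOptimal c V pbar qbar p q ↔ pbar = p ∧ qbar = q ∧ IsOptimal c V p q := by
  have hcost : ∀ (V : NodeMatrix N) (p q : net.Vec),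
      c.C V p + c.G p q = c.Cbar V p q + ∑ h, c.customer h (p h) := fun V p q => by
    simp only [Cost.C, Cost.Cbar]; ring
  constructor
  · rintro ⟨⟨h1, h2, h3, h4⟩, hmin⟩
    obtain rfl : pbar = p := funext h3
    obtain rfl : qbar = q := funext h4
    refine ⟨rfl, rfl, ⟨h1, h2⟩, fun x hx => ?_⟩
    have := hmin (a := ((x.1, x.2.1, x.2.2), (x.2.1, x.2.2)))
      ⟨hx.1, hx.2, fun _ => rfl, fun _ => rfl⟩
    simpa only [Set.mem_ofPred_eq, hcost] using this
  · rintro ⟨rfl, rfl, ⟨h1, h2⟩, hmin⟩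
    refine ⟨⟨h1, h2, fun _ => rfl, fun _ => rfl⟩, ?_⟩
    rintro ⟨⟨V', p', q'⟩, ⟨p'', q''⟩⟩ ⟨h1', h2', h3, h4⟩
    obtain rfl : p' = p'' := funext h3
    obtain rfl : q' = q'' := funext h4
    have := hmin (a := (V', p', q')) ⟨h1', h2'⟩
    simpa only [Set.mem_ofPred_eq, hcost] using this

theorem isOptimal_iff {c : net.Cost} {V : NodeMatrix N} {p q : net.Vec} :
    IsOptimal c V p q ↔ (V, p, q) ∈ net.networkSet ∧ (p, q) ∈ net.inverterSetpoints ∧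
      ∀ x ∈ net.networkSet, x.2 ∈ net.inverterSetpoints →
        c.utilityCost (V, p, q) + c.customerCost (p, q) ≤
          c.utilityCost x + c.customerCost x.2 := by
  have hcost : ∀ x : NodeMatrix N × net.Vec × net.Vec,
      c.C x.1 x.2.1 + c.G x.2.1 x.2.2 = c.utilityCost x + c.customerCost x.2 := fun x => by
    simp only [Cost.C, Cost.utilityCost, Cost.customerCost, Cost.Cbar]; ring
  constructor
  · rintro ⟨⟨h1, h2⟩, hmin⟩
    refine ⟨h1, h2, fun x hx hx' => ?_⟩
    rw [← hcost, ← hcost]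
    exact hmin (a := x) ⟨hx, hx'⟩
  · rintro ⟨h1, h2, hmin⟩
    refine ⟨⟨h1, h2⟩, fun x hx => ?_⟩
    have := hmin x hx.1 hx.2
    rwa [← hcost, ← hcost] at this

theorem isOptimal_of_isConsensusSaddle {c : net.Cost} {x : NodeMatrix N × net.Vec × net.Vec}
    {z : net.Vec × net.Vec} {γ : EuclideanSpace ℝ (net.homes ⊕ net.homes)}
    (h : IsConsensusSaddle net.networkSet net.inverterSetpoints c.utilityCost c.customerCost
      net.utilitySetpoint net.customerSetpoint x z γ) :
    x.2 = z ∧ IsOptimal c x.1 z.1 z.2 := by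
  have hxz : x.2 = z := net.setpointEquiv.injective h.consensus
  refine ⟨hxz, isOptimal_iff.2 ⟨?_, h.right_mem, fun x' hx' hz' => ?_⟩⟩
  · rw [← hxz]; exact h.left_mem
  · have := h.isMinOn hx' hz' rfl
    rwa [← hxz] at this ⊢

/-- The constraint qualification yields a saddle point of the consensus problem. -/
theorem exists_isConsensusSaddle_networkSet {c : net.Cost} (hc : c.IsConvex)
    (hcq : (intrinsicInterior ℝ net.networkSetpoints ∩
      intrinsicInterior ℝ net.inverterSetpoints).Nonempty) :
    ∃ x z γ, IsConsensusSaddle net.networkSet net.inverterSetpoints c.utilityCost c.customerCost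
      net.utilitySetpoint net.customerSetpoint x z γ := by
  have himage : (LinearMap.snd ℝ (NodeMatrix N) (net.Vec × net.Vec)) '' net.networkSet =
      net.networkSetpoints := by
    ext z
    exact ⟨fun ⟨x, hx, hxz⟩ => hxz ▸ ⟨x.1, hx⟩, fun ⟨V, hV⟩ => ⟨(V, z), hV, rfl⟩⟩
  have himage' : (LinearMap.id : net.Vec × net.Vec →ₗ[ℝ] net.Vec × net.Vec) ''
      net.inverterSetpoints = net.inverterSetpoints := by simp
  have hcont : ContinuousOn (fun x => c.utilityCost x + c.customerCost x.2)
      (net.networkSet ∩ Prod.snd ⁻¹' net.inverterSetpoints) :=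
    ((Cost.continuousOn_utilityCost hc).mono Set.inter_subset_left).add
      ((Cost.continuous_customerCost hc).comp continuous_snd).continuousOn
  have hne : (net.networkSet ∩ Prod.snd ⁻¹' net.inverterSetpoints).Nonempty := by
    obtain ⟨z, hz, hz'⟩ := hcq
    obtain ⟨V, hV⟩ := intrinsicInterior_subset hz
    have hz₀ : z ∈ net.inverterSetpoints := intrinsicInterior_subset hz'
    exact ⟨(V, z), hV, hz₀⟩
  -- The constraint qualification provides a feasible point, so compactness provides an optimum to
  -- which a multiplier can be attached.
  obtain ⟨x, ⟨hx, hx'⟩, hmin⟩ := (isCompact_networkSet.inter_right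
    (isCompact_inverterSetpoints.isClosed.preimage continuous_snd)).exists_isMinOn hne hcont
  obtain ⟨γ, hγ⟩ := exists_isConsensusSaddle net.setpointEquiv (Cost.convexOn_utilityCost hc)
    (Cost.convexOn_customerCost hc)
    (isCompact_networkSet.bddAbove_image (Cost.continuousOn_utilityCost hc))
    (isCompact_inverterSetpoints.bddAbove_image (Cost.continuous_customerCost hc).continuousOn)
    (l₁ := LinearMap.snd ℝ (NodeMatrix N) (net.Vec × net.Vec)) (l₂ := LinearMap.id)
    (by rwa [himage, himage']) hx hx' rfl (fun x' hx' y' hy' hxy => by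
      obtain rfl : x'.2 = y' := hxy
      exact hmin ⟨hx', hy'⟩)
  exact ⟨x, x.2, γ, hγ⟩

namespace Iterates

variable {it : net.Iterates}

/-- The utility's iterates. -/
def utilityIterate (it : net.Iterates) (i : ℕ) : NodeMatrix N × net.Vec × net.Vec :=
  (it.V i, it.pbar i, it.qbar i)

/-- The customers' iterates. -/
def customerIterate (it : net.Iterates) (i : ℕ) : net.Vec × net.Vec := (it.p i, it.q i)

/-- The dual iterates as a Euclidean vector. -/
noncomputable def dualIterate (it : net.Iterates) (i : ℕ) :
    EuclideanSpace ℝ (net.homes ⊕ net.homes) := net.setpointEquiv (it.γ i, it.μ i)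

/-- The averages of the two copies of the setpoints. -/
noncomputable def averageIterate (it : net.Iterates) (i : ℕ) :
    EuclideanSpace ℝ (net.homes ⊕ net.homes) :=
  (1 / 2 : ℝ) • (net.utilitySetpoint (it.utilityIterate i) +
    net.customerSetpoint (it.customerIterate i))

theorem averageIterate_inl (i : ℕ) (h : net.homes) :
    it.averageIterate i (Sum.inl h) = (it.pbar i h + it.p i h) / 2 := by
  change (1 / 2 : ℝ) * (it.pbar i h + it.p i h) = _
  ring

theorem averageIterate_inr (i : ℕ) (h : net.homes) :
    it.averageIterate i (Sum.inr h) = (it.qbar i h + it.q i h) / 2 := by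
  change (1 / 2 : ℝ) * (it.qbar i h + it.q i h) = _
  ring

theorem F_eq (κ : ℝ) (i : ℕ) (z : net.Vec × net.Vec) :
    it.F κ i z.1 z.2 = inner ℝ (it.dualIterate i - κ • it.averageIterate i)
      (net.setpointEquiv z) + κ / 2 * ‖net.setpointEquiv z‖ ^ 2 := by
  rw [inner_setpointEquiv, norm_sq_setpointEquiv, Finset.mul_sum, ← Finset.sum_add_distrib]
  refine Finset.sum_congr rfl fun h _ => ?_
  simp only [PiLp.sub_apply, PiLp.smul_apply, averageIterate_inl, averageIterate_inr, dualIterate,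
    setpointEquiv_inl, setpointEquiv_inr, smul_eq_mul]
  ring

/-- The customers' problems are separable, so together they form one minimization over the product
region, of the shape that `IsConsensusADMM.of_isMinOn` takes. -/
theorem sum_customerObjective_eq (c : net.Cost) (κ : ℝ) (i : ℕ) (z : net.Vec × net.Vec) :
    ∑ h, it.customerObjective c κ i h (z.1 h, z.2 h) =
      c.customerCost z + inner ℝ (-(it.dualIterate i + κ • it.averageIterate i))
        (net.setpointEquiv z) + κ / 2 * ‖net.setpointEquiv z‖ ^ 2 := by
  rw [inner_setpointEquiv, norm_sq_setpointEquiv, Finset.mul_sum, Cost.customerCost,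
    ← Finset.sum_add_distrib, ← Finset.sum_add_distrib]
  refine Finset.sum_congr rfl fun h _ => ?_
  simp only [PiLp.neg_apply, PiLp.add_apply, PiLp.smul_apply, averageIterate_inl,
    averageIterate_inr, dualIterate, setpointEquiv_inl, setpointEquiv_inr, smul_eq_mul,
    customerObjective]
  ring

/-- A run of the algorithm is a consensus ADMM sequence. -/
theorem IsRun.isConsensusADMM {c : net.Cost} {κ : ℝ} (hit : it.IsRun c κ) (hc : c.IsConvex) :
    IsConsensusADMM net.networkSet net.inverterSetpoints c.utilityCost c.customerCost
      net.utilitySetpoint net.customerSetpoint κ it.utilityIterate it.customerIterate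
      it.dualIterate it.averageIterate := by
  refine .of_isMinOn (Cost.convexOn_utilityCost hc) (Cost.convexOn_customerCost hc)
    (fun _ => rfl) hit.utility_mem hit.customer_mem (fun i x hx => ?_) (fun i z hz => ?_)
    (fun i => ?_)
  · have := hit.utility_min i hx
    simp only [Set.mem_ofPred_eq] at this ⊢
    rw [add_assoc, add_assoc, utilitySetpoint_apply, utilitySetpoint_apply, ← F_eq, ← F_eq]
    exact this
  · simp only [Set.mem_ofPred_eq, customerSetpoint_apply]
    rw [← sum_customerObjective_eq, ← sum_customerObjective_eq]
    exact Finset.sum_le_sum fun h _ => hit.customer_min i h (hz h)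
  · ext (h | h)
    · exact hit.γ_succ i h
    · exact hit.μ_succ i h

end Iterates

end Feeder

/-! ### Transfer of the abstract convergence result to the feeder. -/

theorem proposition1 {N : ℕ} (net : Feeder N) (c : net.Cost) (hc : c.IsConvex)
    (hcq : (intrinsicInterior ℝ net.networkSetpoints ∩
      intrinsicInterior ℝ net.inverterSetpoints).Nonempty)
    (κ : ℝ) (hκ : 0 < κ) (it : net.Iterates) (hit : it.IsRun c κ) :
    (∀ (V : Feeder.NodeMatrix N) (pbar qbar p q : net.Vec),
      Feeder.IsConsensusOptimal c V pbar qbar p q ↔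
        pbar = p ∧ qbar = q ∧ Feeder.IsOptimal c V p q) ∧
    ∃ (Vopt : Feeder.NodeMatrix N) (popt qopt γlim μlim : net.Vec),
      Feeder.IsOptimal c Vopt popt qopt ∧
      Filter.Tendsto it.p Filter.atTop (nhds popt) ∧
      Filter.Tendsto it.pbar Filter.atTop (nhds popt) ∧
      Filter.Tendsto it.q Filter.atTop (nhds qopt) ∧
      Filter.Tendsto it.qbar Filter.atTop (nhds qopt) ∧
      Filter.Tendsto it.γ Filter.atTop (nhds γlim) ∧
      Filter.Tendsto it.μ Filter.atTop (nhds μlim) ∧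
      (∀ V : Feeder.NodeMatrix N, MapClusterPt V Filter.atTop it.V →
        Feeder.IsOptimal c V popt qopt) ∧
      ((∀ V : Feeder.NodeMatrix N, Feeder.IsOptimal c V popt qopt → V = Vopt) →
        Filter.Tendsto it.V Filter.atTop (nhds Vopt)) := by
  refine ⟨Feeder.isConsensusOptimal_iff c, ?_⟩
  obtain ⟨x₀, z₀, γ₀, h₀⟩ := Feeder.exists_isConsensusSaddle_networkSet hc hcq
  have hadmm := hit.isConsensusADMM hc
  obtain ⟨a, b, ν, hsad, hx, hz, hν, hclus⟩ := hadmm.exists_tendsto hκ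
    Feeder.isCompact_networkSet Feeder.isCompact_inverterSetpoints
    (Feeder.Cost.continuousOn_utilityCost hc) (Feeder.Cost.continuous_customerCost hc).continuousOn
    (net.setpointEquiv.continuous.comp continuous_snd) net.setpointEquiv.continuous h₀
  obtain ⟨hab, hopt⟩ := Feeder.isOptimal_of_isConsensusSaddle hsad
  have hinv : ∀ {u : ℕ → net.Vec × net.Vec} {v : EuclideanSpace ℝ (net.homes ⊕ net.homes)},
      Filter.Tendsto (fun i => net.setpointEquiv (u i)) Filter.atTop (nhds v) →
      Filter.Tendsto u Filter.atTop (nhds (net.setpointEquiv.symm v)) := fun {u v} h => by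
    simpa [Function.comp_def] using (net.setpointEquiv.symm.continuous.tendsto v).comp h
  have hx' := hinv hx
  have hz' := hinv hz
  have hν' := hinv hν
  rw [Feeder.utilitySetpoint_apply, hab, ContinuousLinearEquiv.symm_apply_apply] at hx'
  rw [Feeder.customerSetpoint_apply, ContinuousLinearEquiv.symm_apply_apply] at hz'
  -- An ultrafilter along which the matrices tend to `V` carries the already convergent setpoints
  -- with it, so `(V, b)` and `b` form a saddle point.
  have hcluster : ∀ V : Feeder.NodeMatrix N,
      MapClusterPt V Filter.atTop (fun i => it.V (i + 1)) → Feeder.IsOptimal c V b.1 b.2 := by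
    intro V hV
    obtain ⟨U, hU, hVU⟩ := mapClusterPt_iff_ultrafilter.1 hV
    have hx1 := (hx'.comp (Filter.tendsto_add_atTop_nat 1)).mono_left hU
    have hz1 := (hz'.comp (Filter.tendsto_add_atTop_nat 1)).mono_left hU
    exact (Feeder.isOptimal_of_isConsensusSaddle (hclus U (V, b) b hU
      (hVU.prodMk_nhds hx1) hz1)).2
  refine ⟨a.1, b.1, b.2, _, _, hopt, (continuous_fst.tendsto _).comp hz',
    (continuous_fst.tendsto _).comp hx', (continuous_snd.tendsto _).comp hz',
    (continuous_snd.tendsto _).comp hx', (continuous_fst.tendsto _).comp hν',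
    (continuous_snd.tendsto _).comp hν', fun V hV => hcluster V ?_, fun huniq => ?_⟩
  · rwa [← Filter.map_add_atTop_eq_nat 1] at hV
  · rw [← Filter.tendsto_add_atTop_iff_nat 1]
    -- A sequence in a compact set with only one possible cluster point converges to it.
    exact (Feeder.isCompact_networkSet.image continuous_fst).tendsto_nhds_of_unique_mapClusterPt
      (Filter.Eventually.of_forall fun i => ⟨it.utilityIterate (i + 1), hit.utility_mem i, rfl⟩)
      fun V _ hV => huniq V (hcluster V hV)
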